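/- Let $n \ge 2$, let $S = \{a_1, \dots, a_n\}$ have cardinality $n$, and put $\bar S = \{a_1, \dots, a_n, a_1^{-1}, \dots, a_n^{-1}\}$. Let $M_n$ be the free monoid on $S$ (all words over $S$, including the empty word $e$) and $F_n$ the free group on $S$ (all reduced words over $\bar S$). For a word $v = s_1 \cdots s_l \neq e$ and a word $w = r_1 \cdots r_m$ let $\rho_v(w)$ be the number of $j$ with $0 \le j \le m - l$ such that $s_i = r_{j+i}$ for all $i = 1, \dots, l$ (overlapping occurrences are counted), and let $\rho_e(w) = m$ be the length of $w$. Using words, respectively reduced words, this defines the counting functions $\rho_v : M_n \to \mathbb{R}$ for $v \in M_n$ and $\rho_v : F_n \to \mathbb{R}$ for $v \in F_n$. For $X = M_n$ or $X = F_n$ let $\mathcal{C}(X)$ be the space of real-valued functions on $X$ spanned by $\{\rho_v \mid v \in X\}$, and let $\widehat{\mathcal{C}}(X)$ be the quotient of $\mathcal{C}(X)$ by its subspace of bounded functions. For $w \in F_n$ let $\phi_w = \rho_w - \rho_{w^{-1}}$, and let $\widehat{\mathcal{B}}(F_n) \subset \widehat{\mathcal{C}}(F_n)$ be the span of the classes $[\phi_w]$,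 $w \in F_n$. Let $\mathbb{R}[X]$ be the space of finitely supported functions $X \to \mathbb{R}$, with basis $\{\delta_g\}_{g \in X}$. Let $K(M_n)$, $K(F_n)$ and $K_{\rm sym}(F_n)$ be the kernels of the linear maps $$\mathbb{R}[M_n] \to \widehat{\mathcal{C}}(M_n),\ \delta_g \mapsto [\rho_g]; \qquad \mathbb{R}[F_n] \to \widehat{\mathcal{C}}(F_n),\ \delta_g \mapsto [\rho_g]; \qquad \mathbb{R}[F_n] \to \widehat{\mathcal{B}}(F_n),\ \delta_g \mapsto [\phi_g].$$ For $w \in M_n$ define $$l_w = \delta_w - \sum_{s \in S} \delta_{sw}, \qquad r_w = \delta_w - \sum_{s \in S} \delta_{ws}.$$ For $w \in F_n \setminus \{e\}$ with reduced word having initial letter $w_1$ and final letter $w_{\rm fin}$ define $$l_w = \delta_w - \sum_{s \in \bar S \setminus \{w_1^{-1}\}} \delta_{sw}, \qquad r_w = \delta_w - \sum_{s \in \bar S \setminus \{w_{\rm fin}^{-1}\}} \delta_{ws},$$ and for $w = e \in F_n$ let $l_e = r_e = \delta_e - \sum_{s \in \bar S} \delta_s$. For every $w \in F_n$ let $s_w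 = \delta_w + \delta_{w^{-1}}$. Then: (i) $K(M_n)$ is the real linear span of $\bigcup_{w \in M_n} \{l_w, r_w\}$. (ii) $K(F_n)$ is the real linear span of $\bigcup_{w \in F_n} \{l_w, r_w\}$. (iii) $K_{\rm sym}(F_n)$ is the real linear span of $\bigcup_{w \in F_n} \{l_w, r_w, s_w\}$. -/

import Mathlib

namespace Counting

section General

variable {X : Type*}

/-- The space of bounded real-valued functions on a set `X`. -/
def boundedFunctions (X : Type*) : Submodule ℝ (X → ℝ) where
  carrier := {f | ∃ C : ℝ, ∀ x, |f x| ≤ C}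
  zero_mem' := ⟨0, fun x => by simp⟩
  add_mem' := by
    rintro f g ⟨C, hC⟩ ⟨D, hD⟩
    exact ⟨C + D, fun x => (abs_add_le _ _).trans (add_le_add (hC x) (hD x))⟩
  smul_mem' := by
    rintro c f ⟨C, hC⟩
    refine ⟨|c| * C, fun x => ?_⟩
    simpa [abs_mul] using mul_le_mul_of_nonneg_left (hC x) (abs_nonneg c)

/-- The space of functions spanned by a family `ρ` of functions (below: the counting functions). -/
def spanSpace (ρ : X → X → ℝ) : Submodule ℝ (X → ℝ) :=
  Submodule.span ℝ (Set.range ρ)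

/-- The bounded elements of `spanSpace ρ`. -/
def boundedPart (ρ : X → X → ℝ) : Submodule ℝ (spanSpace ρ) :=
  (boundedFunctions X).comap (spanSpace ρ).subtype

/-- Equivalence classes of elements of `spanSpace ρ`, two of them being equivalent if they differ
by a bounded function. -/
abbrev SpanSpaceHat (ρ : X → X → ℝ) : Type _ :=
  spanSpace ρ ⧸ boundedPart ρ

/-- The equivalence class `[ρ_v]`. -/
def hatClass (ρ : X → X → ℝ) (v : X) : SpanSpaceHat ρ :=
  (boundedPart ρ).mkQ ⟨ρ v, Submodule.subset_span (Set.mem_range_self v)⟩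

/-- The linear map sending `∑ λ_g δ_g` to the class of `∑ λ_g ρ_g`. Finitely supported real-valued
functions on `X` are elements of `X →₀ ℝ`, and `δ_g` is `Finsupp.single g 1`. -/
noncomputable def quotientMap (ρ : X → X → ℝ) : (X →₀ ℝ) →ₗ[ℝ] SpanSpaceHat ρ :=
  Finsupp.linearCombination ℝ (hatClass ρ)

/-- The function `δ_g`, with value `1` at `g` and `0` elsewhere. -/
noncomputable def delta (g : X) : X →₀ ℝ :=
  Finsupp.single g 1

end General

section Words

variable {A : Type*} [DecidableEq A]

/-- The number of (possibly overlapping) occurrences of the word `v = s₁ ⋯ s_l` in the word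
`w = r₁ ⋯ r_m`: the number of positions `j` with `0 ≤ j` and `j + l ≤ m` such that
`s_i = r_(j+i)` for all `1 ≤ i ≤ l`. For the empty word `v` it is, by convention, the length
of `w`. -/
def occurrences (v w : List A) : ℕ :=
  if v = [] then w.length
  else ((Finset.range (w.length + 1)).filter fun j =>
    j + v.length ≤ w.length ∧ (w.drop j).take v.length = v).card

end Words

section Monoid

variable {S : Type*} [DecidableEq S]

/-- The counting function `ρ_v` on the free monoid on `S`. -/
def rhoMonoid (v w : FreeMonoid S) : ℝ :=
  (occurrences v.toList w.toList : ℝ)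

variable [Fintype S]

/-- The left-extension relation `l_w = δ_w - ∑_{s ∈ S} δ_{sw}` in the free monoid. -/
noncomputable def leftMonoid (w : FreeMonoid S) : FreeMonoid S →₀ ℝ :=
  delta w - ∑ s : S, delta (FreeMonoid.of s * w)

/-- The right-extension relation `r_w = δ_w - ∑_{s ∈ S} δ_{ws}` in the free monoid. -/
noncomputable def rightMonoid (w : FreeMonoid S) : FreeMonoid S →₀ ℝ :=
  delta w - ∑ s : S, delta (w * FreeMonoid.of s)

end Monoid

section Group

variable {S : Type*} [DecidableEq S]

/-- The counting function `ρ_v` on the free group on `S`: occurrences of the reduced word of `v`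
in the reduced word of `w`. -/
def rhoGroup (v w : FreeGroup S) : ℝ :=
  (occurrences v.toWord w.toWord : ℝ)

/-- The inverse of a letter of the alphabet `S ∪ S⁻¹`; the pair `(a, true)` stands for the letter
`a` and `(a, false)` for the letter `a⁻¹`. -/
def invLetter (s : S × Bool) : S × Bool :=
  (s.1, !s.2)

/-- The group element given by a letter of the alphabet `S ∪ S⁻¹`. -/
def ofLetter (s : S × Bool) : FreeGroup S :=
  FreeGroup.mk [s]

/-- The class `[φ_w]` of the function `φ_w = ρ_w - ρ_{w⁻¹}`. -/
def brooksClass (w : FreeGroup S) : SpanSpaceHat (rhoGroup (S := S)) :=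
  (boundedPart rhoGroup).mkQ
    ⟨rhoGroup w - rhoGroup w⁻¹,
      Submodule.sub_mem _ (Submodule.subset_span (Set.mem_range_self w))
        (Submodule.subset_span (Set.mem_range_self w⁻¹))⟩

/-- The Brooks space: the span of the classes `[φ_w]`. -/
def brooksSpace (S : Type*) [DecidableEq S] : Submodule ℝ (SpanSpaceHat (rhoGroup (S := S))) :=
  Submodule.span ℝ (Set.range brooksClass)

/-- The linear map sending `∑ λ_g δ_g` to the class of `∑ λ_g φ_g`. -/
noncomputable def symQuotientMap (S : Type*) [DecidableEq S] : (FreeGroup S →₀ ℝ) →ₗ[ℝ] brooksSpace S :=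
  Finsupp.linearCombination ℝ fun w =>
    ⟨brooksClass w, Submodule.subset_span (Set.mem_range_self w)⟩

/-- The symmetry relation `s_w = δ_w + δ_{w⁻¹}`. -/
noncomputable def symRelation (w : FreeGroup S) : FreeGroup S →₀ ℝ :=
  delta w + delta w⁻¹

variable [Fintype S]

/-- The left-extension relation `l_w = δ_w - ∑ δ_{sw}` in the free group, where `s` runs over all
letters of `S ∪ S⁻¹` other than the inverse of the initial letter of `w` (over all letters if `w`
is trivial). -/
noncomputable def leftGroup (w : FreeGroup S) : FreeGroup S →₀ ℝ :=
  delta w - ∑ s : S × Bool with w.toWord.head?.map invLetter ≠ some s, delta (ofLetter s * w)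

/-- The right-extension relation `r_w = δ_w - ∑ δ_{ws}` in the free group, where `s` runs over all
letters of `S ∪ S⁻¹` other than the inverse of the final letter of `w` (over all letters if `w`
is trivial). -/
noncomputable def rightGroup (w : FreeGroup S) : FreeGroup S →₀ ℝ :=
  delta w - ∑ s : S × Bool with w.toWord.getLast?.map invLetter ≠ some s, delta (w * ofLetter s)

end Group

end Counting

/-! Free monoid and free group are treated together, as words whose consecutive letters satisfy a
relation `R` (`WordCoding`). The relations lie in the kernel because every occurrence of `v` in `w`
extends uniquely by one letter to the left, except one at the start of `w`, and likewise on the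
right. Conversely, right-extension relations bring any `f` into a combination of words of one length
`M + 1` with `M ≠ 0`. View these words as edges from `dropLast` to `tail` between words of length
`M`: appending a letter to `w` changes `∑ f_v ρ_v` by the coefficient of the edge just traversed
(`eval_concat`). If this function is bounded, let `h u` be its supremum over words ending in `u`.
Then `f y ≤ h (tail y) - h (dropLast y)`, and the right-hand side is the coefficient at `y` of `∑ h
u (r_u - l_u)`. The difference is a nonnegative combination of counting functions and is bounded,
hence zero, since copies of any nonempty word can be chained (`exists_isChain_le_occurrences`). Part
(iii) follows by splitting `f` into its odd and even parts under inversion. -/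

namespace Counting

/-! ### Counting occurrences of words -/

section Occurrences

variable {A : Type*} [DecidableEq A]

lemma occurrences_nil (w : List A) : occurrences [] w = w.length := by
  simp [occurrences]

lemma occurrences_of_nil (v : List A) : occurrences v [] = 0 := by
  by_cases hv : v = []
  · simp [occurrences, hv]
  · simp [occurrences, hv]

lemma occurrences_cons {v : List A} (hv : v ≠ []) (a : A) (w : List A) :
    occurrences v (a :: w) = occurrences v w + if v <+: a :: w then 1 else 0 := by
  have key : ∀ w : List A, occurrences v w =
      ∑ j ∈ Finset.range (w.length + 1), if v <+: w.drop j then 1 else 0 := by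
    intro w
    rw [occurrences, if_neg hv, Finset.card_filter]
    refine Finset.sum_congr rfl fun j hj => ?_
    have hj' : j ≤ w.length := by simpa [Nat.lt_succ_iff] using hj
    congr 1
    rw [List.prefix_iff_eq_take, eq_iff_iff]
    constructor
    · exact fun h => h.2.symm
    · intro h
      refine ⟨?_, h.symm⟩
      have := congrArg List.length h
      simp at this
      omega
  -- Position `0` is split off; the remaining positions are those of the tail.
  rw [key, key, List.length_cons, Finset.sum_range_succ']
  simp

lemma occurrences_concat {v : List A} (hv : v ≠ []) (w : List A) (a : A) :
    occurrences v (w ++ [a]) = occurrences v w + if v <:+ w ++ [a] then 1 else 0 := by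
  induction w with
  | nil =>
    rw [List.nil_append, occurrences_cons hv]
    congr 2
    rw [eq_iff_iff]
    have h : v <+: [a] ∨ v <:+ [a] → v = [a] := by
      rcases v with _ | ⟨b, v⟩
      · exact absurd rfl hv
      · rintro (h | h)
        · exact h.eq_of_length_le (by simp)
        · exact h.eq_of_length_le (by simp)
    constructor
    · intro h'
      rw [h (.inl h')]
    · intro h'
      rw [h (.inr h')]
  | cons b w ih =>
    rw [List.cons_append, occurrences_cons hv, occurrences_cons hv, ih]
    -- If `v` is shorter than the whole word, a prefix test ignores the last letter and a suffix
    -- test the first. Otherwise `v` can only occur as the whole word, where prefix and suffix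
    -- coincide.
    rcases le_or_gt v.length (w.length + 1) with hl | hl
    · have h1 : (v <+: b :: (w ++ [a])) = (v <+: b :: w) := by
        rw [eq_iff_iff]
        constructor
        · intro h
          exact List.prefix_of_prefix_length_le h ⟨[a], by simp⟩ (by simpa using hl)
        · exact fun h => h.trans ⟨[a], by simp⟩
      have h2 : (v <:+ b :: (w ++ [a])) = (v <:+ w ++ [a]) := by
        rw [eq_iff_iff, List.suffix_cons_iff]
        constructor
        · rintro (h | h)
          · subst h
            simp at hl
          · exact h
        · exact Or.inr
      simp only [h1, h2]
      omega
    · have h1 : ¬ v <+: b :: w := fun h => by have := h.length_le; simp at this; omega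
      have h2 : ¬ v <:+ w ++ [a] := fun h => by have := h.length_le; simp at this; omega
      have h3 : (v <+: b :: (w ++ [a])) = (v <:+ b :: (w ++ [a])) := by
        rw [eq_iff_iff]
        constructor
        · intro h
          rw [h.eq_of_length_le (by simp; omega)]
        · intro h
          rw [h.eq_of_length_le (by simp; omega)]
      simp only [h1, h2, h3, if_false, add_zero]

lemma occurrences_le_append (v w x : List A) : occurrences v w ≤ occurrences v (w ++ x) := by
  by_cases hv : v = []
  · simp [hv, occurrences_nil]
  · induction x using List.reverseRecOn with
    | nil => simp
    | append_singleton x a ih =>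
      rw [← List.append_assoc, occurrences_concat hv]
      omega

/-- Copies of `v` are concatenated, with a bridging letter from `hR` between consecutive ones. -/
lemma exists_isChain_le_occurrences {R : A → A → Prop}
    (hR : ∀ a b, ∃ c, R a c ∧ R c b) {v : List A}
    (hv : v ≠ []) (hvR : v.IsChain R) (k : ℕ) :
    ∃ w : List A, w.IsChain R ∧ k ≤ occurrences v w := by
  -- Keeping `v` as a suffix makes `w` nonempty, so there is a last letter to bridge from.
  suffices ∃ w : List A, w.IsChain R ∧ v <:+ w ∧ k ≤ occurrences v w by
    obtain ⟨w, h1, -, h2⟩ := this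
    exact ⟨w, h1, h2⟩
  induction k with
  | zero => exact ⟨v, hvR, List.suffix_rfl, Nat.zero_le _⟩
  | succ k ih =>
    obtain ⟨w, hw, hvw, hk⟩ := ih
    have hw0 : w ≠ [] := by
      rintro rfl
      exact hv (List.suffix_nil.mp hvw)
    obtain ⟨c, hc1, hc2⟩ := hR (w.getLast hw0) (v.head hv)
    refine ⟨w ++ c :: v, hw.append (hvR.cons ?_) ?_, ⟨w ++ [c], by simp⟩, ?_⟩
    · intro y hy
      rw [List.head?_eq_some_head hv] at hy
      simp at hy
      exact hy ▸ hc2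
    · intro x hx y hy
      rw [List.getLast?_eq_some_getLast hw0] at hx
      simp at hx hy
      subst hx hy
      exact hc1
    -- The last letter of the new copy completes one more occurrence.
    · obtain ⟨u, a, rfl⟩ : ∃ u a, v = u ++ [a] := ⟨_, _, (List.dropLast_append_getLast hv).symm⟩
      have h := occurrences_concat hv (w ++ c :: u) a
      rw [if_pos ⟨w ++ [c], by simp⟩] at h
      have h' := occurrences_le_append (u ++ [a]) w (c :: u)
      rw [show w ++ c :: (u ++ [a]) = w ++ c :: u ++ [a] by simp, h]
      omega

variable [Fintype A] {R : A → A → Prop}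

open Classical in
-- Each occurrence has a unique preceding letter unless it starts `w`. For empty `v` the count is
-- the length, the sum of all letter counts, so there is no defect.
lemma occurrences_eq_sum_cons {v w : List A} (hw : w.IsChain R) :
    occurrences v w = (∑ s : A with (s :: v).IsChain R, occurrences (s :: v) w) +
      if v ≠ [] ∧ v <+: w then 1 else 0 := by
  induction w with
  | nil =>
    rw [Finset.sum_eq_zero fun s _ => occurrences_of_nil _, if_neg, occurrences_of_nil]
    simp
  | cons a w ih =>
    have hsum : ∀ s, occurrences (s :: v) (a :: w) =
        occurrences (s :: v) w + if s = a ∧ v <+: w then 1 else 0 := fun s => by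
      rw [occurrences_cons (by simp)]
      simp only [List.cons_prefix_cons]
    have hlast : (∑ s : A with (s :: v).IsChain R, if s = a ∧ v <+: w then 1 else 0) =
        if v <+: w then 1 else 0 := by
      by_cases h : v <+: w
      -- The preceding letter is admissible because `w` itself is a chain.
      · have ha : (a :: v).IsChain R := hw.prefix (by simpa using h)
        simp [h, ha]
      · simp [h]
    rw [Finset.sum_congr rfl fun s _ => hsum s, Finset.sum_add_distrib, hlast]
    have ih := ih hw.tail
    by_cases hv : v = []
    · simp only [hv, occurrences_nil, List.length_cons] at ih ⊢
      simp at ih ⊢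
      omega
    · rw [occurrences_cons hv]
      simp only [ne_eq, hv, not_false_eq_true, true_and] at ih ⊢
      omega

open Classical in
lemma occurrences_eq_sum_concat {v w : List A} (hw : w.IsChain R) :
    occurrences v w = (∑ s : A with (v ++ [s]).IsChain R, occurrences (v ++ [s]) w) +
      if v ≠ [] ∧ v <:+ w then 1 else 0 := by
  induction w using List.reverseRecOn with
  | nil =>
    rw [Finset.sum_eq_zero fun s _ => occurrences_of_nil _, if_neg, occurrences_of_nil]
    simp
  | append_singleton w a ih =>
    have hsum : ∀ s, occurrences (v ++ [s]) (w ++ [a]) =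
        occurrences (v ++ [s]) w + if s = a ∧ v <:+ w then 1 else 0 := fun s => by
      rw [occurrences_concat (by simp)]
      congr 2
      rw [eq_iff_iff, List.suffix_concat_iff]
      simp
    have hlast : (∑ s : A with (v ++ [s]).IsChain R, if s = a ∧ v <:+ w then 1 else 0) =
        if v <:+ w then 1 else 0 := by
      by_cases h : v <:+ w
      · have ha : (v ++ [a]).IsChain R := hw.suffix (by
          obtain ⟨t, rfl⟩ := h
          exact ⟨t, by simp⟩)
        simp [h, ha]
      · simp [h]
    rw [Finset.sum_congr rfl fun s _ => hsum s, Finset.sum_add_distrib, hlast]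
    have ih := ih hw.left_of_append
    by_cases hv : v = []
    · simp only [hv, occurrences_nil, List.length_append] at ih ⊢
      simp at ih ⊢
      omega
    · rw [occurrences_concat hv]
      simp only [ne_eq, hv, not_false_eq_true, true_and] at ih ⊢
      omega

end Occurrences

/-! ### The kernel in terms of bounded functions -/

section Kernel

variable {X : Type*}

lemma mem_ker_quotientMap {ρ : X → X → ℝ} {f : X →₀ ℝ} :
    f ∈ LinearMap.ker (quotientMap ρ) ↔ Finsupp.linearCombination ℝ ρ f ∈ boundedFunctions X := by
  have h1 : quotientMap ρ = (boundedPart ρ).mkQ ∘ₗ Finsupp.linearCombination ℝ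
      (fun v => (⟨ρ v, Submodule.subset_span (Set.mem_range_self v)⟩ : spanSpace ρ)) := by
    ext v
    simp [quotientMap, hatClass]
  have h2 : Finsupp.linearCombination ℝ ρ = (spanSpace ρ).subtype ∘ₗ Finsupp.linearCombination ℝ
      (fun v => (⟨ρ v, Submodule.subset_span (Set.mem_range_self v)⟩ : spanSpace ρ)) := by
    ext v
    simp
  rw [h1, h2, LinearMap.mem_ker, LinearMap.comp_apply, Submodule.mkQ_apply,
    Submodule.Quotient.mk_eq_zero]
  rfl

end Kernel

/-! ### Words with restricted transitions and their extension relations -/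

/-- An identification of a type with the words over the alphabet `A` all of whose pairs of
consecutive letters are related by `R`. -/
structure WordCoding {A : Type*} (R : A → A → Prop) (X : Type*) where
  word : X → List A
  ofWord : List A → X
  isChain_word : ∀ x, (word x).IsChain R
  ofWord_word : ∀ x, ofWord (word x) = x
  word_ofWord : ∀ l : List A, l.IsChain R → word (ofWord l) = l

namespace WordCoding

variable {A X : Type*} {R : A → A → Prop} (c : WordCoding R X)

lemma word_injective : Function.Injective c.word :=
  Function.LeftInverse.injective c.ofWord_word

/-- The counting functions of a word coding. -/
def rho [DecidableEq A] (v w : X) : ℝ :=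
  (occurrences (c.word v) (c.word w) : ℝ)

lemma exists_le_rho [DecidableEq A] (hR : ∀ a b, ∃ c, R a c ∧ R c b) {v : X}
    (hv : c.word v ≠ []) (K : ℝ) : ∃ w, K ≤ c.rho v w := by
  obtain ⟨k, hk⟩ := exists_nat_ge K
  obtain ⟨w, hw, h⟩ := exists_isChain_le_occurrences hR hv (c.isChain_word v) k
  refine ⟨c.ofWord w, hk.trans ?_⟩
  rw [rho, c.word_ofWord w hw]
  exact_mod_cast h

section Eval

variable [DecidableEq A]

/-- The function `∑ f_v ρ_v`. -/
noncomputable def eval : (X →₀ ℝ) →ₗ[ℝ] (X → ℝ) :=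
  Finsupp.linearCombination ℝ c.rho

lemma eval_delta (v : X) : c.eval (delta v) = c.rho v := by
  simp [eval, delta]

lemma eval_apply (f : X →₀ ℝ) (w : X) : c.eval f w = ∑ v ∈ f.support, f v * c.rho v w := by
  simp [eval, Finsupp.linearCombination_apply, Finsupp.sum]

/-- Among words of length `M + 1`, only the suffix `y` gains an occurrence when the last letter is
appended. -/
lemma eval_concat {M : ℕ} {f : X →₀ ℝ}
    (hf : f ∈ Finsupp.supported ℝ ℝ {y | (c.word y).length = M + 1}) {w y : List A} {a : A}
    (hy : y.length = M + 1) (hw : (w ++ [a]).IsChain R) (hyw : y <:+ w ++ [a]) :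
    c.eval f (c.ofWord (w ++ [a])) = c.eval f (c.ofWord w) + f (c.ofWord y) := by
  classical
  have hyR : y.IsChain R := hw.suffix hyw
  have key : ∀ v ∈ f.support, f v * c.rho v (c.ofWord (w ++ [a])) =
      f v * c.rho v (c.ofWord w) + if v = c.ofWord y then f v else 0 := by
    intro v hv
    have hvl : (c.word v).length = M + 1 := hf hv
    have hv0 : c.word v ≠ [] := by
      intro h0
      simp [h0] at hvl
    have e : c.word v <:+ w ++ [a] ↔ v = c.ofWord y := by
      rw [← c.word_injective.eq_iff, c.word_ofWord _ hyR]
      constructor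
      · intro h
        exact (List.suffix_of_suffix_length_le h hyw (by omega)).eq_of_length (by omega)
      · exact fun h => h ▸ hyw
    rw [rho, rho, c.word_ofWord _ hw, c.word_ofWord _ hw.left_of_append,
      occurrences_concat hv0]
    simp only [e]
    split_ifs <;> push_cast <;> ring
  rw [eval_apply, eval_apply, Finset.sum_congr rfl key, Finset.sum_add_distrib,
    Finset.sum_ite_eq']
  simp +contextual

end Eval

variable [Fintype A]

open Classical in
/-- The left-extension relation of a word coding. -/
noncomputable def left (w : X) : X →₀ ℝ :=
  delta w - ∑ s : A with (s :: c.word w).IsChain R, delta (c.ofWord (s :: c.word w))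

open Classical in
/-- The right-extension relation of a word coding. -/
noncomputable def right (w : X) : X →₀ ℝ :=
  delta w - ∑ s : A with (c.word w ++ [s]).IsChain R, delta (c.ofWord (c.word w ++ [s]))

/-- The span of the extension relations. -/
noncomputable def relations : Submodule ℝ (X →₀ ℝ) :=
  Submodule.span ℝ (⋃ w : X, {c.left w, c.right w})

lemma left_mem (w : X) : c.left w ∈ c.relations :=
  Submodule.subset_span (Set.mem_iUnion.mpr ⟨w, by simp⟩)

lemma right_mem (w : X) : c.right w ∈ c.relations :=
  Submodule.subset_span (Set.mem_iUnion.mpr ⟨w, by simp⟩)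

lemma finite_length_word (N : ℕ) : {x | (c.word x).length = N}.Finite :=
  Set.Finite.preimage c.word_injective.injOn (List.finite_length_eq A N)

/-- Words of length at most `N` are, modulo the relations, combinations of words of
length `N`. -/
lemma delta_mem_sup {N : ℕ} (k : ℕ) (x : X) (hx : (c.word x).length + k = N) :
    delta x ∈ c.relations ⊔ Finsupp.supported ℝ ℝ {y | (c.word y).length = N} := by
  classical
  induction k generalizing x with
  | zero => exact Submodule.mem_sup_right (Finsupp.single_mem_supported ℝ 1 (by simpa using hx))
  | succ k ih =>
    have h : delta x = c.right x + ∑ s : A with (c.word x ++ [s]).IsChain R,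
        delta (c.ofWord (c.word x ++ [s])) := by
      simp [right]
    rw [h]
    refine Submodule.add_mem _ (Submodule.mem_sup_left (c.right_mem x))
      (Submodule.sum_mem _ fun s hs => ih _ ?_)
    rw [c.word_ofWord _ (Finset.mem_filter.mp hs).2]
    simp
    omega

/-- The condition `M ≠ 0` makes consecutive edges overlap in a nonempty word, so that gluing them
along the overlap yields a chain. -/
lemma exists_mem_sup (f : X →₀ ℝ) : ∃ M : ℕ, M ≠ 0 ∧
    f ∈ c.relations ⊔ Finsupp.supported ℝ ℝ {y | (c.word y).length = M + 1} := by
  obtain ⟨M, hM⟩ : ∃ M, ∀ x ∈ f.support, (c.word x).length ≤ M :=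
    ⟨f.support.sup fun x => (c.word x).length, fun x hx =>
      Finset.le_sup (f := fun x => (c.word x).length) hx⟩
  refine ⟨M + 1, M.succ_ne_zero, ?_⟩
  rw [← Finsupp.sum_single f]
  refine Submodule.sum_mem _ fun x hx => ?_
  have := hM x hx
  rw [← mul_one (f x), ← smul_eq_mul, ← Finsupp.smul_single]
  exact Submodule.smul_mem _ _
    (c.delta_mem_sup (M + 2 - (c.word x).length) x (by omega))

open Classical in
lemma left_apply_of_cons {s : A} {l : List A} {u v : X} (hu : (c.word u).length = l.length)
    (hv : c.word v = s :: l) : c.left u v = if c.word u = l then -1 else 0 := by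
  classical
  have h0 : u ≠ v := by
    rintro rfl
    simp [hv] at hu
  have h1 : ∀ t : A, (t :: c.word u).IsChain R →
      (delta (c.ofWord (t :: c.word u)) v = if t = s ∧ c.word u = l then (1 : ℝ) else 0) := by
    intro t ht
    rw [delta, Finsupp.single_apply]
    congr 1
    rw [← c.word_injective.eq_iff, c.word_ofWord _ ht, hv, List.cons.injEq]
  rw [left, Finsupp.sub_apply, Finsupp.finsetSum_apply,
    Finset.sum_congr rfl fun t ht => h1 t (Finset.mem_filter.mp ht).2]
  by_cases h : c.word u = l
  · have hs : (s :: l).IsChain R := hv ▸ c.isChain_word v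
    simp [h, delta, h0, hs]
  · simp [h, delta, h0]

open Classical in
lemma right_apply_of_concat {s : A} {l : List A} {u v : X}
    (hu : (c.word u).length = l.length)
    (hv : c.word v = l ++ [s]) : c.right u v = if c.word u = l then -1 else 0 := by
  classical
  have h0 : u ≠ v := by
    rintro rfl
    simp [hv] at hu
  have h1 : ∀ t : A, (c.word u ++ [t]).IsChain R →
      (delta (c.ofWord (c.word u ++ [t])) v = if t = s ∧ c.word u = l then (1 : ℝ) else 0) := by
    intro t ht
    rw [delta, Finsupp.single_apply]
    congr 1
    rw [← c.word_injective.eq_iff, c.word_ofWord _ ht, hv]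
    simp [and_comm]
  rw [right, Finsupp.sub_apply, Finsupp.finsetSum_apply,
    Finset.sum_congr rfl fun t ht => h1 t (Finset.mem_filter.mp ht).2]
  by_cases h : c.word u = l
  · have hs : (l ++ [s]).IsChain R := hv ▸ c.isChain_word v
    simp [h, delta, h0, hs]
  · simp [h, delta, h0]

lemma left_apply_eq_zero {u v : X} (h1 : (c.word v).length ≠ (c.word u).length)
    (h2 : (c.word v).length ≠ (c.word u).length + 1) : c.left u v = 0 := by
  classical
  have h0 : u ≠ v := by
    rintro rfl
    exact h1 rfl
  rw [left, Finsupp.sub_apply, Finsupp.finsetSum_apply, Finset.sum_eq_zero, delta,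
    Finsupp.single_apply, if_neg h0, sub_zero]
  intro t ht
  rw [delta, Finsupp.single_apply, if_neg]
  rintro rfl
  rw [c.word_ofWord _ (Finset.mem_filter.mp ht).2] at h2
  simp at h2

lemma right_apply_eq_zero {u v : X} (h1 : (c.word v).length ≠ (c.word u).length)
    (h2 : (c.word v).length ≠ (c.word u).length + 1) : c.right u v = 0 := by
  classical
  have h0 : u ≠ v := by
    rintro rfl
    exact h1 rfl
  rw [right, Finsupp.sub_apply, Finsupp.finsetSum_apply, Finset.sum_eq_zero, delta,
    Finsupp.single_apply, if_neg h0, sub_zero]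
  intro t ht
  rw [delta, Finsupp.single_apply, if_neg]
  rintro rfl
  rw [c.word_ofWord _ (Finset.mem_filter.mp ht).2] at h2
  simp at h2

/-- Every potential `h` on the words of length `M` yields an element of the span of the relations,
supported on words of length `M + 1`, whose coefficients are the differences of `h`. -/
lemma exists_mem_relations_of_potential (M : ℕ) (h : List A → ℝ) :
    ∃ p ∈ c.relations, p ∈ Finsupp.supported ℝ ℝ {y | (c.word y).length = M + 1} ∧
      ∀ y, (c.word y).length = M + 1 → p y = h (c.word y).tail - h (c.word y).dropLast := by
  classical
  set U := (c.finite_length_word M).toFinset with hU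
  have hUm : ∀ u, u ∈ U ↔ (c.word u).length = M := by simp [hU]
  -- In `r_u - l_u` the terms `δ_u` cancel, leaving the incoming edges `su` minus the outgoing edges
  -- `us`.
  refine ⟨∑ u ∈ U, h (c.word u) • (c.right u - c.left u), ?_, ?_, ?_⟩
  · exact Submodule.sum_mem _ fun u _ => Submodule.smul_mem _ _
      (Submodule.sub_mem _ (c.right_mem u) (c.left_mem u))
  · rw [Finsupp.mem_supported']
    intro v hv
    rw [Finsupp.finsetSum_apply]
    refine Finset.sum_eq_zero fun u hu => ?_
    have hu := (hUm u).mp hu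
    simp only [Set.mem_ofPred_eq] at hv
    rw [Finsupp.smul_apply, Finsupp.sub_apply]
    by_cases hvM : (c.word v).length = M
    · have h1 : ∀ t, (t :: c.word u).IsChain R → delta (c.ofWord (t :: c.word u)) v = (0 : ℝ) := by
        intro t ht
        rw [delta, Finsupp.single_apply, if_neg]
        rintro rfl
        rw [c.word_ofWord _ ht] at hvM
        simp at hvM
        omega
      have h2 : ∀ t, (c.word u ++ [t]).IsChain R →
          delta (c.ofWord (c.word u ++ [t])) v = (0 : ℝ) := by
        intro t ht
        rw [delta, Finsupp.single_apply, if_neg]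
        rintro rfl
        rw [c.word_ofWord _ ht] at hvM
        simp at hvM
        omega
      rw [left, right, Finsupp.sub_apply, Finsupp.sub_apply, Finsupp.finsetSum_apply,
        Finsupp.finsetSum_apply, Finset.sum_eq_zero fun t ht => h1 t (Finset.mem_filter.mp ht).2,
        Finset.sum_eq_zero fun t ht => h2 t (Finset.mem_filter.mp ht).2]
      simp
    · rw [c.left_apply_eq_zero (by omega) (by omega), c.right_apply_eq_zero (by omega) (by omega)]
      simp
  · intro y hy
    have hne : c.word y ≠ [] := by
      intro h0
      simp [h0] at hy
    have hl : ∀ u ∈ U, h (c.word u) * c.left u y =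
        if u = c.ofWord (c.word y).tail then - h (c.word y).tail else 0 := by
      intro u hu
      rw [c.left_apply_of_cons (l := (c.word y).tail) (by simp [(hUm u).mp hu, hy])
        (List.cons_head_tail hne).symm]
      have e : c.word u = (c.word y).tail ↔ u = c.ofWord (c.word y).tail := by
        rw [← c.word_injective.eq_iff, c.word_ofWord _ (c.isChain_word y).tail]
      by_cases hh : c.word u = (c.word y).tail
      · rw [if_pos hh, if_pos (e.mp hh), hh, mul_neg_one]
      · rw [if_neg hh, if_neg (e.not.mp hh), mul_zero]
    have hr : ∀ u ∈ U, h (c.word u) * c.right u y =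
        if u = c.ofWord (c.word y).dropLast then - h (c.word y).dropLast else 0 := by
      intro u hu
      rw [c.right_apply_of_concat (l := (c.word y).dropLast) (by simp [(hUm u).mp hu, hy])
        (List.dropLast_append_getLast hne).symm]
      have e : c.word u = (c.word y).dropLast ↔ u = c.ofWord (c.word y).dropLast := by
        rw [← c.word_injective.eq_iff, c.word_ofWord _ (c.isChain_word y).dropLast]
      by_cases hh : c.word u = (c.word y).dropLast
      · rw [if_pos hh, if_pos (e.mp hh), hh, mul_neg_one]
      · rw [if_neg hh, if_neg (e.not.mp hh), mul_zero]
    rw [Finsupp.finsetSum_apply]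
    simp only [Finsupp.smul_apply, Finsupp.sub_apply, smul_eq_mul, mul_sub]
    rw [Finset.sum_sub_distrib, Finset.sum_congr rfl hl, Finset.sum_congr rfl hr,
      Finset.sum_ite_eq', Finset.sum_ite_eq', if_pos, if_pos]
    · ring
    · rw [hUm, c.word_ofWord _ (c.isChain_word y).tail]; simp [hy]
    · rw [hUm, c.word_ofWord _ (c.isChain_word y).dropLast]; simp [hy]

variable [DecidableEq A]

lemma eval_mem_of_mem_relations {f : X →₀ ℝ} (hf : f ∈ c.relations) :
    c.eval f ∈ boundedFunctions X := by
  classical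
  suffices c.relations ≤ (boundedFunctions X).comap c.eval from this hf
  refine Submodule.span_le.mpr (Set.iUnion_subset fun w => ?_)
  rintro _ (rfl | rfl)
  · refine ⟨1, fun x => ?_⟩
    have h := occurrences_eq_sum_cons (v := c.word w) (c.isChain_word x)
    have e : ∑ s : A with (s :: c.word w).IsChain R, c.rho (c.ofWord (s :: c.word w)) x =
        ∑ s : A with (s :: c.word w).IsChain R, (occurrences (s :: c.word w) (c.word x) : ℝ) :=
      Finset.sum_congr rfl fun s hs => by rw [rho, c.word_ofWord _ (Finset.mem_filter.mp hs).2]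
    rw [left, map_sub, map_sum, Pi.sub_apply, Finset.sum_apply]
    simp only [eval_delta]
    rw [e, rho, h]
    push_cast
    split_ifs <;> simp
  · refine ⟨1, fun x => ?_⟩
    have h := occurrences_eq_sum_concat (v := c.word w) (c.isChain_word x)
    have e : ∑ s : A with (c.word w ++ [s]).IsChain R, c.rho (c.ofWord (c.word w ++ [s])) x =
        ∑ s : A with (c.word w ++ [s]).IsChain R, (occurrences (c.word w ++ [s]) (c.word x) : ℝ) :=
      Finset.sum_congr rfl fun s hs => by rw [rho, c.word_ofWord _ (Finset.mem_filter.mp hs).2]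
    rw [right, map_sub, map_sum, Pi.sub_apply, Finset.sum_apply]
    simp only [eval_delta]
    rw [e, rho, h]
    push_cast
    split_ifs <;> simp

/-- A combination of counting functions for words of a fixed length, at least two, is bounded only if it
belongs to the span of the relations. -/
lemma mem_relations_of_supported (hR : ∀ a b, ∃ c, R a c ∧ R c b) {M : ℕ} (hM : M ≠ 0) {f : X →₀ ℝ}
    (hf : f ∈ Finsupp.supported ℝ ℝ {y | (c.word y).length = M + 1})
    (hb : c.eval f ∈ boundedFunctions X) : f ∈ c.relations := by
  obtain ⟨C, hC⟩ := hb
  -- The supremum of `T u` is the potential. If `u` is not a chain, `T u` is empty and its supremum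
  -- is `0`; such `u` never arise as `tail` or `dropLast` of a coded word.
  set T : List A → Set ℝ := fun u => {z | ∃ w : X, u <:+ c.word w ∧ c.eval f w = z} with hT
  obtain ⟨p, hp, hps, hpv⟩ := c.exists_mem_relations_of_potential M fun u => sSup (T u)
  have hbdd : ∀ u, BddAbove (T u) := by
    rintro u
    refine ⟨C, ?_⟩
    rintro _ ⟨w, -, rfl⟩
    exact (abs_le.mp (hC w)).2
  have hnonneg : ∀ y, 0 ≤ (p - f) y := by
    intro y
    by_cases hy : (c.word y).length = M + 1
    · have hne : c.word y ≠ [] := by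
        intro h0
        simp [h0] at hy
      rw [Finsupp.sub_apply, hpv y hy]
      -- Any word ending in `dropLast y` extends by the last letter of `y` to one ending in `tail
      -- y`, and the value grows by `f y`.
      have hle : sSup (T (c.word y).dropLast) ≤ sSup (T (c.word y).tail) - f y := by
        refine csSup_le ⟨_, c.ofWord (c.word y).dropLast, ?_, rfl⟩ ?_
        · rw [c.word_ofWord _ (c.isChain_word y).dropLast]
        · rintro _ ⟨w, hw, rfl⟩
          set a := (c.word y).getLast hne with ha
          have hya : c.word y = (c.word y).dropLast ++ [a] :=
            (List.dropLast_append_getLast hne).symm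
          have hyw : c.word y <:+ c.word w ++ [a] := by
            obtain ⟨t, ht⟩ := hw
            refine ⟨t, ?_⟩
            rw [← ht, List.append_assoc, ← hya]
          have hchain : (c.word w ++ [a]).IsChain R := by
            obtain ⟨t, ht⟩ := hw
            rw [← ht]
            refine List.IsChain.append_overlap (ht ▸ c.isChain_word w)
              (hya ▸ c.isChain_word y) fun h0 => hM ?_
            simpa [hy] using congrArg List.length h0
          have h := c.eval_concat hf hy hchain hyw
          rw [c.ofWord_word, c.ofWord_word] at h
          have := le_csSup (hbdd (c.word y).tail) ⟨c.ofWord (c.word w ++ [a]), by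
            rw [c.word_ofWord _ hchain]
            exact (List.tail_suffix _).trans hyw, rfl⟩
          linarith
      linarith
    · rw [(Finsupp.mem_supported' ℝ _).mp (Submodule.sub_mem _ hps hf) y hy]
  -- A positive coefficient at `v` would make the bounded function `eval (p - f)` unbounded along
  -- words with many copies of `v`.
  have hpf : p - f = 0 := by
    by_contra hne
    obtain ⟨v, hv⟩ := Finsupp.support_nonempty_iff.mpr hne
    have hpos : 0 < (p - f) v := (hnonneg v).lt_of_ne' (Finsupp.mem_support_iff.mp hv)
    obtain ⟨D, hD⟩ := c.eval_mem_of_mem_relations hp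
    have hvl : (c.word v).length = M + 1 := Submodule.sub_mem _ hps hf hv
    obtain ⟨w, hw⟩ := c.exists_le_rho hR (v := v) (fun h0 => by simp [h0] at hvl)
      ((D + C + 1) / (p - f) v)
    have h1 : (p - f) v * c.rho v w ≤ c.eval (p - f) w := by
      rw [eval_apply]
      exact Finset.single_le_sum (f := fun v => (p - f) v * c.rho v w)
        (fun u _ => mul_nonneg (hnonneg u) (Nat.cast_nonneg _)) hv
    have h2 : c.eval (p - f) w ≤ D + C := by
      rw [map_sub, Pi.sub_apply]
      linarith [(abs_le.mp (hD w)).2, (abs_le.mp (hC w)).1]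
    rw [div_le_iff₀' hpos] at hw
    linarith
  rwa [← sub_eq_zero.mp hpf]

theorem ker_quotientMap (hR : ∀ a b, ∃ c, R a c ∧ R c b) :
    LinearMap.ker (quotientMap c.rho) = c.relations := by
  ext f
  rw [mem_ker_quotientMap]
  change c.eval f ∈ _ ↔ _
  refine ⟨fun h => ?_, c.eval_mem_of_mem_relations⟩
  obtain ⟨M, hM0, hM⟩ := c.exists_mem_sup f
  obtain ⟨p, hp, q, hq, rfl⟩ := Submodule.mem_sup.mp hM
  refine Submodule.add_mem _ hp (c.mem_relations_of_supported hR hM0 hq ?_)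
  rw [map_add] at h
  exact (Submodule.add_mem_iff_right _ (c.eval_mem_of_mem_relations hp)).mp h

end WordCoding

/-! ### The free monoid -/

section Monoid

variable {S : Type*}

/-- The elements of the free monoid as words without any restriction. -/
def monoidCoding (S : Type*) : WordCoding (fun _ _ : S => True) (FreeMonoid S) where
  word := FreeMonoid.toList
  ofWord := FreeMonoid.ofList
  isChain_word _ := List.isChain_iff_getElem.mpr fun _ _ => trivial
  ofWord_word _ := rfl
  word_ofWord _ _ := rfl

variable [Fintype S]

lemma monoidCoding_left (w : FreeMonoid S) : (monoidCoding S).left w = leftMonoid w := by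
  classical
  rw [WordCoding.left, leftMonoid]
  congr 1
  exact Finset.sum_congr (@Finset.filter_true_of_mem _ _ (_) _ fun s _ =>
    (monoidCoding S).isChain_word (.ofList (s :: w.toList))) fun _ _ => rfl

lemma monoidCoding_right (w : FreeMonoid S) : (monoidCoding S).right w = rightMonoid w := by
  classical
  rw [WordCoding.right, rightMonoid]
  congr 1
  exact Finset.sum_congr (@Finset.filter_true_of_mem _ _ (_) _ fun s _ =>
    (monoidCoding S).isChain_word (.ofList (w.toList ++ [s]))) fun _ _ => rfl

theorem ker_quotientMap_rhoMonoid [DecidableEq S] [Nonempty S] :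
    LinearMap.ker (quotientMap (rhoMonoid (S := S))) =
      Submodule.span ℝ (⋃ w : FreeMonoid S, {leftMonoid w, rightMonoid w}) := by
  have h := (monoidCoding S).ker_quotientMap fun a _ => ⟨a, trivial, trivial⟩
  simp only [WordCoding.relations, monoidCoding_left, monoidCoding_right] at h
  exact h

end Monoid

/-! ### The free group and the inversion symmetry -/

section Group

variable {S : Type*}

/-- The linear map with `δ_w ↦ δ_{w⁻¹}`. -/
noncomputable def invMap (S : Type*) : (FreeGroup S →₀ ℝ) →ₗ[ℝ] (FreeGroup S →₀ ℝ) :=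
  Finsupp.lmapDomain ℝ ℝ (·⁻¹)

lemma invMap_delta (w : FreeGroup S) : invMap S (delta w) = delta w⁻¹ := by
  simp [invMap, delta, Finsupp.mapDomain_single]

lemma invMap_invMap (f : FreeGroup S →₀ ℝ) : invMap S (invMap S f) = f := by
  simp [invMap, ← Finsupp.mapDomain_comp]

lemma add_invMap_mem (f : FreeGroup S →₀ ℝ) :
    f + invMap S f ∈ Submodule.span ℝ (Set.range (symRelation (S := S))) := by
  induction f using Finsupp.induction_linear with
  | zero => simp
  | add f g hf hg =>
    rw [map_add, add_add_add_comm]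
    exact Submodule.add_mem _ hf hg
  | single w a =>
    have h : (Finsupp.single w a : FreeGroup S →₀ ℝ) = a • delta w := by simp [delta]
    rw [h, map_smul, invMap_delta, ← smul_add]
    exact Submodule.smul_mem _ _ (Submodule.subset_span ⟨w, rfl⟩)

lemma ofLetter_inv (s : S × Bool) : (ofLetter s)⁻¹ = ofLetter (invLetter s) := by
  simp [ofLetter, invLetter, FreeGroup.inv_mk, FreeGroup.invRev]

lemma invLetter_involutive : Function.Involutive (invLetter (S := S)) := fun s => by
  simp [invLetter]

lemma map_invLetter_ne_some_iff (o : Option (S × Bool)) (s : S × Bool) :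
    o.map invLetter ≠ some s ↔ ∀ y ∈ o, s.1 = y.1 → s.2 = y.2 := by
  rcases s with ⟨s, b⟩
  rcases o with _ | ⟨y, b'⟩
  · simp
  · cases b <;> cases b' <;> simp [invLetter, @eq_comm _ s y]

variable [DecidableEq S]

lemma ofLetter_mul (s : S × Bool) (w : FreeGroup S) :
    ofLetter s * w = FreeGroup.mk (s :: w.toWord) := by
  conv_lhs => rw [← FreeGroup.mk_toWord (x := w)]
  rfl

lemma mul_ofLetter (w : FreeGroup S) (s : S × Bool) :
    w * ofLetter s = FreeGroup.mk (w.toWord ++ [s]) := by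
  conv_lhs => rw [← FreeGroup.mk_toWord (x := w)]
  rfl

lemma getLast?_toWord_inv (w : FreeGroup S) :
    w⁻¹.toWord.getLast? = w.toWord.head?.map invLetter := by
  rw [FreeGroup.toWord_inv]
  simp [FreeGroup.invRev]
  rfl

lemma symQuotientMap_coe (f : FreeGroup S →₀ ℝ) :
    (symQuotientMap S f : SpanSpaceHat (rhoGroup (S := S))) =
      quotientMap rhoGroup (f - invMap S f) := by
  suffices (brooksSpace S).subtype ∘ₗ symQuotientMap S =
      quotientMap rhoGroup ∘ₗ (LinearMap.id - invMap S) from LinearMap.congr_fun this f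
  ext w
  have h := invMap_delta w
  rw [delta] at h
  simp [symQuotientMap, quotientMap, h, delta]
  rfl

lemma mem_ker_symQuotientMap {f : FreeGroup S →₀ ℝ} :
    f ∈ LinearMap.ker (symQuotientMap S) ↔
      f - invMap S f ∈ LinearMap.ker (quotientMap (rhoGroup (S := S))) := by
  rw [LinearMap.mem_ker, LinearMap.mem_ker, ← symQuotientMap_coe, ZeroMemClass.coe_eq_zero]

/-- The elements of the free group as reduced words. -/
def groupCoding (S : Type*) [DecidableEq S] :
    WordCoding (fun a b : S × Bool => a.1 = b.1 → a.2 = b.2) (FreeGroup S) where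
  word := FreeGroup.toWord
  ofWord := FreeGroup.mk
  isChain_word _ := FreeGroup.isReduced_toWord
  ofWord_word _ := FreeGroup.mk_toWord
  word_ofWord _ h := FreeGroup.IsReduced.reduce_eq h

/-- If `ab` is reduced, `a` itself bridges. Otherwise `b = a⁻¹`, and any other generator does. -/
lemma exists_bridge [Nontrivial S] (a b : S × Bool) :
    ∃ c : S × Bool, (a.1 = c.1 → a.2 = c.2) ∧ (c.1 = b.1 → c.2 = b.2) := by
  by_cases h : a.1 = b.1 → a.2 = b.2
  · exact ⟨a, fun _ => rfl, h⟩
  · obtain ⟨s, hs⟩ := exists_ne a.1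
    push Not at h
    exact ⟨(s, true), fun h' => absurd h'.symm hs, fun h' => absurd (h'.trans h.1.symm) hs⟩

variable [Fintype S]

lemma groupCoding_left (w : FreeGroup S) : (groupCoding S).left w = leftGroup w := by
  classical
  rw [WordCoding.left, leftGroup]
  congr 1
  refine Finset.sum_congr ?_ fun s _ => by rw [ofLetter_mul]; rfl
  ext s
  rw [@Finset.mem_filter _ _ (_), @Finset.mem_filter _ _ (_), map_invLetter_ne_some_iff, List.isChain_cons]
  exact and_congr_right fun _ => and_iff_left ((groupCoding S).isChain_word w)

lemma groupCoding_right (w : FreeGroup S) : (groupCoding S).right w = rightGroup w := by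
  classical
  rw [WordCoding.right, rightGroup]
  congr 1
  refine Finset.sum_congr ?_ fun s _ => by rw [mul_ofLetter]; rfl
  ext s
  rw [@Finset.mem_filter _ _ (_), @Finset.mem_filter _ _ (_), map_invLetter_ne_some_iff, List.isChain_append]
  refine and_congr_right fun _ => ⟨fun h y hy he => (h.2.2 y hy s rfl he.symm).symm, fun h =>
    ⟨(groupCoding S).isChain_word w, List.isChain_singleton s, fun y hy z hz he => ?_⟩⟩
  obtain rfl : s = z := by simpa using hz
  exact (h y hy he.symm).symm

theorem ker_quotientMap_rhoGroup [Nontrivial S] :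
    LinearMap.ker (quotientMap (rhoGroup (S := S))) =
      Submodule.span ℝ (⋃ w : FreeGroup S, {leftGroup w, rightGroup w}) := by
  have h := (groupCoding S).ker_quotientMap exists_bridge
  simp only [WordCoding.relations, groupCoding_left, groupCoding_right] at h
  exact h

/-- Inversion reverses words, so it exchanges left and right extensions. -/
lemma invMap_leftGroup (w : FreeGroup S) : invMap S (leftGroup w) = rightGroup w⁻¹ := by
  rw [leftGroup, rightGroup, map_sub, map_sum, invMap_delta]
  congr 1
  refine Finset.sum_nbij' invLetter invLetter ?_ ?_ (fun s _ => invLetter_involutive s)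
    (fun s _ => invLetter_involutive s) ?_
  · intro s
    simp only [Finset.mem_filter, Finset.mem_univ, true_and, getLast?_toWord_inv]
    intro h h'
    apply h
    rw [Option.map_map, invLetter_involutive.comp_self, Option.map_id, id] at h'
    rw [h', Option.map_some, invLetter_involutive]
  · intro s
    simp only [Finset.mem_filter, Finset.mem_univ, true_and, getLast?_toWord_inv]
    intro h h'
    apply h
    rw [h', Option.map_some, invLetter_involutive]
  · intro s _
    rw [invMap_delta, mul_inv_rev, ofLetter_inv]

lemma invMap_rightGroup (w : FreeGroup S) : invMap S (rightGroup w) = leftGroup w⁻¹ := by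
  rw [← invMap_invMap (leftGroup w⁻¹), invMap_leftGroup, inv_inv]

theorem ker_symQuotientMap [Nontrivial S] :
    LinearMap.ker (symQuotientMap S) =
      Submodule.span ℝ (⋃ w : FreeGroup S, {leftGroup w, rightGroup w, symRelation w}) := by
  have hleft (w : FreeGroup S) : leftGroup w ∈ LinearMap.ker (quotientMap (rhoGroup (S := S))) := by
    rw [ker_quotientMap_rhoGroup]
    exact Submodule.subset_span (Set.mem_iUnion.mpr ⟨w, by simp⟩)
  have hright (w : FreeGroup S) :
      rightGroup w ∈ LinearMap.ker (quotientMap (rhoGroup (S := S))) := by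
    rw [ker_quotientMap_rhoGroup]
    exact Submodule.subset_span (Set.mem_iUnion.mpr ⟨w, by simp⟩)
  apply le_antisymm
  · intro f hf
    rw [mem_ker_symQuotientMap, ker_quotientMap_rhoGroup] at hf
    -- The odd part lies in the span of the extension relations by (ii), the even part in that of
    -- the symmetry relations.
    have h : f = (2⁻¹ : ℝ) • ((f - invMap S f) + (f + invMap S f)) := by
      rw [sub_add_add_cancel, ← two_smul ℝ f, smul_smul]
      norm_num
    rw [h]
    refine Submodule.smul_mem _ _ (Submodule.add_mem _ (Submodule.span_mono ?_ hf)
      (Submodule.span_mono ?_ (add_invMap_mem f)))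
    · exact Set.iUnion_mono fun w => by grind
    · rintro _ ⟨w, rfl⟩
      exact Set.mem_iUnion.mpr ⟨w, by simp⟩
  · refine Submodule.span_le.mpr (Set.iUnion_subset fun w => ?_)
    rintro _ (rfl | rfl | rfl) <;> rw [SetLike.mem_coe, mem_ker_symQuotientMap]
    · rw [invMap_leftGroup]
      exact Submodule.sub_mem _ (hleft w) (hright w⁻¹)
    · rw [invMap_rightGroup]
      exact Submodule.sub_mem _ (hright w) (hleft w⁻¹)
    · rw [symRelation, map_add, invMap_delta, invMap_delta, inv_inv, add_comm, sub_self]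
      exact Submodule.zero_mem _

end Group

end Counting

theorem theorem1p3 (n : ℕ) (hn : 2 ≤ n) :
    LinearMap.ker (Counting.quotientMap (Counting.rhoMonoid (S := Fin n))) =
        Submodule.span ℝ (⋃ w : FreeMonoid (Fin n),
          {Counting.leftMonoid w, Counting.rightMonoid w}) ∧
      LinearMap.ker (Counting.quotientMap (Counting.rhoGroup (S := Fin n))) =
        Submodule.span ℝ (⋃ w : FreeGroup (Fin n),
          {Counting.leftGroup w, Counting.rightGroup w}) ∧
      LinearMap.ker (Counting.symQuotientMap (Fin n)) =
        Submodule.span ℝ (⋃ w : FreeGroup (Fin n),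
          {Counting.leftGroup w, Counting.rightGroup w, Counting.symRelation w}) := by
  have : Nontrivial (Fin n) := Fin.nontrivial_iff_two_le.mpr hn
  exact ⟨Counting.ker_quotientMap_rhoMonoid, Counting.ker_quotientMap_rhoGroup,
    Counting.ker_symQuotientMap⟩
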